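/- For a real number $0<\rho<1$ and an integer $N>1$, let $\mu_{\rho,N}$ denote the unique Borel probability measure on $\mathbb R$ satisfying $$\mu_{\rho,N}(E)=\frac1N\sum_{j=0}^{N-1}\mu_{\rho,N}(\rho^{-1}E-j)\qquad\text{for every Borel set }E\subset\mathbb R .$$ Call a probability measure $\mu$ on $\mathbb R$ *spectral* if there is a countable set $\Lambda\subset\mathbb R$ such that $\{e^{-2\pi i\lambda x}:\lambda\in\Lambda\}$ is an orthonormal basis of $L^2(\mu)$. **Proposition.** Let $N>1$ be an integer and let $\rho=p/q\in(0,1)$, where $p,q$ are coprime positive integers. If $p>1$ and $N\mid q$, then $\mu_{\rho,N}$ is not a spectral measure. -/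

import Mathlib

open MeasureTheory
open scoped ENNReal

/-- The self-similarity equation of the `N`-Bernoulli measure with contraction ratio `ρ`:
`μ(E) = (1/N) ∑_{j=0}^{N-1} μ(ρ⁻¹E - j)` for every Borel set `E`. -/
def IsBernoulliSelfSimilar (ρ : ℝ) (N : ℕ) (μ : Measure ℝ) : Prop :=
  ∀ E : Set ℝ, MeasurableSet E →
    μ E = (N : ℝ≥0∞)⁻¹ * ∑ j ∈ Finset.range N, μ ((fun x : ℝ => ρ⁻¹ * x - j) '' E)

theorem bernoulli_image_eq {ρ : ℝ} (hρ : 0 < ρ) (j : ℕ) (E : Set ℝ) :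
    (fun x : ℝ => ρ⁻¹ * x - j) '' E = (fun y : ℝ => ρ * (y + j)) ⁻¹' E := by
  ext y
  simp only [Set.mem_image, Set.mem_preimage]
  constructor
  · rintro ⟨x, hx, rfl⟩
    have : ρ * (ρ⁻¹ * x - j + j) = x := by field_simp; ring
    rwa [this]
  · intro hy
    exact ⟨_, hy, by field_simp; ring⟩

theorem IsBernoulliSelfSimilar.eq_sum_map {ρ : ℝ} (hρ : 0 < ρ) {N : ℕ} {μ : Measure ℝ}
    (h : IsBernoulliSelfSimilar ρ N μ) :
    μ = (N : ℝ≥0∞)⁻¹ • ∑ j ∈ Finset.range N, μ.map (fun y : ℝ => ρ * (y + j)) := by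
  ext E hE
  rw [h E hE]
  simp only [Measure.smul_apply, Measure.finsetSum_apply, smul_eq_mul]
  congr 1
  refine Finset.sum_congr rfl fun j _ => ?_
  rw [bernoulli_image_eq hρ, Measure.map_apply (by fun_prop) hE]

theorem IsBernoulliSelfSimilar.charFun_eq {ρ : ℝ} (hρ : 0 < ρ) {N : ℕ}
    {μ : Measure ℝ} [IsProbabilityMeasure μ] (h : IsBernoulliSelfSimilar ρ N μ) (t : ℝ) :
    charFun μ t = ((N : ℂ)⁻¹ * ∑ j ∈ Finset.range N, Complex.exp (ρ * t * j * Complex.I)) *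
      charFun μ (ρ * t) := by
  have hint : ∀ (ν : Measure ℝ) [IsFiniteMeasure ν],
      Integrable (fun x : ℝ => Complex.exp (t * x * Complex.I)) ν := by
    intro ν _
    refine Integrable.of_bound (by fun_prop) 1 (Filter.Eventually.of_forall fun x => ?_)
    have := Complex.norm_exp_ofReal_mul_I (t * x)
    push_cast at this
    exact this.le
  conv_lhs => rw [charFun_apply_real, h.eq_sum_map hρ]
  rw [integral_smul_measure, integral_finsetSum_measure (fun j _ => hint _)]
  rw [mul_assoc, Finset.sum_mul, charFun_apply_real]
  simp only [ENNReal.toReal_inv, ENNReal.toReal_natCast, Complex.real_smul]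
  push_cast
  congr 1
  refine Finset.sum_congr rfl fun j _ => ?_
  rw [integral_map (by fun_prop) (by fun_prop), ← integral_const_mul]
  refine integral_congr_ae (Filter.Eventually.of_forall fun x => ?_)
  simp only
  rw [← Complex.exp_add]
  congr 1
  push_cast
  ring

theorem IsBernoulliSelfSimilar.unique {ρ : ℝ} (h0 : 0 < ρ) (h1 : ρ < 1) {N : ℕ}
    {μ ν : Measure ℝ} [IsProbabilityMeasure μ] [IsProbabilityMeasure ν]
    (hμ : IsBernoulliSelfSimilar ρ N μ) (hν : IsBernoulliSelfSimilar ρ N ν) : μ = ν := by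
  have hM : ∀ t : ℝ, ‖(N : ℂ)⁻¹ * ∑ j ∈ Finset.range N,
      Complex.exp (ρ * t * j * Complex.I)‖ ≤ 1 := by
    intro t
    rw [norm_mul, norm_inv, Complex.norm_natCast]
    have : ‖∑ j ∈ Finset.range N, Complex.exp (ρ * t * j * Complex.I)‖ ≤ N := by
      refine (norm_sum_le _ _).trans ?_
      have : ∀ j ∈ Finset.range N, ‖Complex.exp (ρ * t * j * Complex.I)‖ ≤ 1 := by
        intro j _
        have := Complex.norm_exp_ofReal_mul_I (ρ * t * j)
        push_cast at this
        exact this.le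
      simpa using Finset.sum_le_sum this
    rw [inv_mul_eq_div]
    exact div_le_one_of_le₀ this (by positivity)
  have step : ∀ t : ℝ, ‖charFun μ t - charFun ν t‖ ≤
      ‖charFun μ (ρ * t) - charFun ν (ρ * t)‖ := by
    intro t
    rw [hμ.charFun_eq h0 t, hν.charFun_eq h0 t, ← mul_sub, norm_mul]
    exact mul_le_of_le_one_left (norm_nonneg _) (hM t)
  have iter : ∀ (n : ℕ) (t : ℝ), ‖charFun μ t - charFun ν t‖ ≤
      ‖charFun μ (ρ ^ n * t) - charFun ν (ρ ^ n * t)‖ := by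
    intro n
    induction n with
    | zero => intro t; simp
    | succ n ih =>
      intro t
      refine (ih t).trans ((step _).trans_eq ?_)
      rw [pow_succ', mul_assoc]
  refine Measure.ext_of_charFun (funext fun t => ?_)
  have hc : Continuous fun s : ℝ => ‖charFun μ s - charFun ν s‖ :=
    (continuous_charFun.sub continuous_charFun).norm
  have ht : Filter.Tendsto (fun n : ℕ => ρ ^ n * t) Filter.atTop (nhds 0) := by
    simpa using (tendsto_pow_atTop_nhds_zero_of_lt_one h0.le h1).mul_const t
  have hl := (hc.tendsto 0).comp ht
  have hz : ‖charFun μ 0 - charFun ν 0‖ = 0 := by simp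
  rw [hz] at hl
  have := ge_of_tendsto' hl (fun n => iter n t)
  exact sub_eq_zero.1 (norm_le_zero_iff.1 this)

theorem exists_isBernoulliSelfSimilar {ρ : ℝ} (h0 : 0 < ρ) (h1 : ρ < 1) {N : ℕ} (hN : 0 < N) :
    ∃ μ : Measure ℝ, IsProbabilityMeasure μ ∧ IsBernoulliSelfSimilar ρ N μ := by
  have hN0 : (N : ℝ≥0∞) ≠ 0 := by exact_mod_cast hN.ne'
  let u : Measure (Fin N) := (N : ℝ≥0∞)⁻¹ • ∑ j : Fin N, Measure.dirac j
  have hu : IsProbabilityMeasure u := ⟨by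
    simp [u, ENNReal.inv_mul_cancel hN0 (ENNReal.natCast_ne_top N)]⟩
  let P : Measure (ℕ → Fin N) := Measure.infinitePi fun _ => u
  let cons : Fin N → (ℕ → Fin N) → ℕ → Fin N := fun j ω n => Nat.casesOn n j ω
  have hcons : ∀ j, Measurable (cons j) := by
    intro j
    refine measurable_pi_lambda _ fun n => ?_
    cases n with
    | zero => exact measurable_const
    | succ n => exact measurable_pi_apply n
  have hP : (N : ℝ≥0∞)⁻¹ • ∑ j : Fin N, P.map (cons j) = P := by
    refine Measure.eq_infinitePi _ fun s t ht => ?_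
    classical
    obtain ⟨n, hn⟩ := s.exists_nat_subset_range
    let t' : ℕ → Set (Fin N) := fun i => if i ∈ s then t i else Set.univ
    have hs1 : Set.pi (s : Set ℕ) t = Set.pi (Finset.range (n + 1) : Set ℕ) t' := by
      ext ω
      simp only [Set.mem_pi, Finset.mem_coe, t']
      constructor
      · intro h i _
        split_ifs with hi
        · exact h i hi
        · trivial
      · intro h i hi
        have := h i (Finset.mem_range.2 ((Finset.mem_range.1 (hn hi)).trans (Nat.lt_succ_self n)))
        simpa [hi] using this
    have hs2 : ∏ i ∈ s, u (t i) = ∏ i ∈ Finset.range (n + 1), u (t' i) := by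
      have hsub : s ⊆ Finset.range (n + 1) :=
        hn.trans (Finset.range_mono (Nat.le_succ n))
      rw [← Finset.prod_subset hsub]
      · exact Finset.prod_congr rfl fun i hi => by simp [t', hi]
      · intro i _ hi
        simp [t', hi]
    have hm : ∀ i, MeasurableSet (t' i) := fun i => Set.toFinite _ |>.measurableSet
    rw [hs1, hs2, Finset.prod_range_succ']
    have hpre : ∀ j : Fin N, P.map (cons j) (Set.pi (Finset.range (n + 1) : Set ℕ) t') =
        (Set.indicator (t' 0) 1 j) * ∏ i ∈ Finset.range n, u (t' (i + 1)) := by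
      intro j
      rw [Measure.map_apply (hcons j) (.pi (Finset.countable_toSet _) fun i _ => hm i)]
      by_cases hj : j ∈ t' 0
      · have : cons j ⁻¹' (Set.pi (Finset.range (n + 1) : Set ℕ) t') =
            Set.pi (Finset.range n : Set ℕ) (fun i => t' (i + 1)) := by
          ext ω
          simp only [Set.mem_preimage, Set.mem_pi, Finset.mem_coe, Finset.mem_range]
          constructor
          · intro h i hi
            exact h (i + 1) (by omega)
          · intro h i hi
            cases i with
            | zero => exact hj
            | succ i => exact h i (by omega)
        rw [this, Measure.infinitePi_pi _ (fun i _ => hm _)]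
        simp [hj]
      · have : cons j ⁻¹' (Set.pi (Finset.range (n + 1) : Set ℕ) t') = ∅ := by
          ext ω
          simp only [Set.mem_preimage, Set.mem_pi, Finset.mem_coe, Finset.mem_range,
            Set.mem_empty_iff_false, iff_false]
          intro h
          exact hj (h 0 (by omega))
        rw [this]
        simp [hj]
    simp only [Measure.smul_apply, Measure.finsetSum_apply, hpre, smul_eq_mul]
    rw [← Finset.sum_mul, ← mul_assoc, mul_comm]
    congr 1
    simp [u, Measure.dirac_apply' _ (hm 0)]
  let X : (ℕ → Fin N) → ℝ := fun ω => ∑' n, ρ ^ (n + 1) * ((ω n : ℕ) : ℝ)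
  have hg : Summable fun n : ℕ => ρ ^ (n + 1) * (N : ℝ) :=
    ((summable_nat_add_iff 1).2 (summable_geometric_of_lt_one h0.le h1)).mul_right _
  have hb : ∀ (n : ℕ) (ω : ℕ → Fin N), ‖ρ ^ (n + 1) * ((ω n : ℕ) : ℝ)‖ ≤ ρ ^ (n + 1) * N := by
    intro n ω
    rw [Real.norm_of_nonneg (by positivity)]
    have : ((ω n : ℕ) : ℝ) ≤ N := by exact_mod_cast (ω n).2.le
    gcongr
  have hX : Measurable X := by
    refine (continuous_tsum (fun n => ?_) hg hb).measurable
    exact continuous_const.mul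
      ((continuous_of_discreteTopology (f := fun j : Fin N => ((j : ℕ) : ℝ))).comp
        (continuous_apply n))
  have hXc : ∀ j ω, X (cons j ω) = ρ * (X ω + ((j : ℕ) : ℝ)) := by
    intro j ω
    have hsum : ∀ ω : ℕ → Fin N, Summable fun n => ρ ^ (n + 1) * ((ω n : ℕ) : ℝ) :=
      fun ω => Summable.of_norm_bounded hg fun n => hb n ω
    change ∑' n : ℕ, ρ ^ (n + 1) * ((Fin.val (cons j ω n) : ℕ) : ℝ) = _
    rw [(hsum _).tsum_eq_zero_add]
    change ρ ^ (0 + 1) * ((j : ℕ) : ℝ) + ∑' n, ρ ^ (n + 1 + 1) * ((ω n : ℕ) : ℝ) = _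
    have : ∑' n, ρ ^ (n + 1 + 1) * ((ω n : ℕ) : ℝ) = ρ * X ω := by
      rw [← tsum_mul_left]
      exact tsum_congr fun n => by ring
    rw [this]
    ring
  refine ⟨P.map X, Measure.isProbabilityMeasure_map hX.aemeasurable, fun E hE => ?_⟩
  rw [Measure.map_apply hX hE]
  conv_lhs => rw [← hP]
  simp only [Measure.smul_apply, Measure.finsetSum_apply, smul_eq_mul]
  congr 1
  rw [Finset.sum_range]
  refine Finset.sum_congr rfl fun j _ => ?_
  rw [bernoulli_image_eq h0, Measure.map_apply hX (hE.preimage (by fun_prop)),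
    Measure.map_apply (hcons j) (hX hE)]
  congr 1
  ext ω
  simp [hXc]

theorem existsUnique_isBernoulliSelfSimilar {ρ : ℝ} (h0 : 0 < ρ) (h1 : ρ < 1) {N : ℕ}
    (hN : 0 < N) :
    ∃! μ : Measure ℝ, IsProbabilityMeasure μ ∧ IsBernoulliSelfSimilar ρ N μ := by
  obtain ⟨μ, hp, hs⟩ := exists_isBernoulliSelfSimilar h0 h1 hN
  refine ⟨μ, ⟨hp, hs⟩, ?_⟩
  rintro ν ⟨hp', hs'⟩
  exact hs'.unique h0 h1 hs

/-- The `N`-Bernoulli measure `μ_{ρ,N}`: the unique Borel probability measure on `ℝ` satisfying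
`μ(E) = (1/N) ∑_{j=0}^{N-1} μ(ρ⁻¹E - j)`. -/
noncomputable def nBernoulli (ρ : ℝ) (N : ℕ) (h0 : 0 < ρ) (h1 : ρ < 1) (hN : 0 < N) :
    Measure ℝ :=
  (existsUnique_isBernoulliSelfSimilar h0 h1 hN).choose

instance nBernoulli.isProbabilityMeasure (ρ : ℝ) (N : ℕ) (h0 : 0 < ρ) (h1 : ρ < 1)
    (hN : 0 < N) : IsProbabilityMeasure (nBernoulli ρ N h0 h1 hN) :=
  (existsUnique_isBernoulliSelfSimilar h0 h1 hN).choose_spec.1.1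

theorem nBernoulli_selfSimilar (ρ : ℝ) (N : ℕ) (h0 : 0 < ρ) (h1 : ρ < 1) (hN : 0 < N) :
    IsBernoulliSelfSimilar ρ N (nBernoulli ρ N h0 h1 hN) :=
  (existsUnique_isBernoulliSelfSimilar h0 h1 hN).choose_spec.1.2

/-- The exponential function `e_l(x) = e^{-2πi l x}`. -/
noncomputable def expFun (l : ℝ) (x : ℝ) : ℂ :=
  Complex.exp (-(2 * Real.pi * Complex.I * l * x))

theorem memLp_expFun (μ : Measure ℝ) [IsFiniteMeasure μ] (l : ℝ) : MemLp (expFun l) 2 μ := by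
  refine MemLp.of_bound (by unfold expFun; fun_prop) 1 (Filter.Eventually.of_forall fun x => ?_)
  have h : -(2 * Real.pi * Complex.I * l * x) = ((-(2 * Real.pi * l * x) : ℝ) : ℂ) * Complex.I := by
    push_cast
    ring
  rw [expFun, h, Complex.norm_exp_ofReal_mul_I]

/-- The class of `e_l` in `L²(μ)`. -/
noncomputable def expL2 (μ : Measure ℝ) [IsFiniteMeasure μ] (l : ℝ) : Lp ℂ 2 μ :=
  (memLp_expFun μ l).toLp (expFun l)

/-- `Λ` is a spectrum of the probability measure `μ`: `Λ` is countable and the family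
`(e_l)_{l ∈ Λ}` is an orthonormal (Hilbert) basis of `L²(μ)`. -/
def IsSpectrum (μ : Measure ℝ) [IsProbabilityMeasure μ] (Λ : Set ℝ) : Prop :=
  Λ.Countable ∧ ∃ b : HilbertBasis Λ ℂ (Lp ℂ 2 μ), ∀ l : Λ, b l = expL2 μ l

/-- A probability measure is spectral if it has a spectrum. -/
def IsSpectralMeasure (μ : Measure ℝ) [IsProbabilityMeasure μ] : Prop :=
  ∃ Λ : Set ℝ, IsSpectrum μ Λ

/-!
Write `ρ = p / q`, let `M` be the Fourier transform of the uniform distribution on the digits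
`0, …, N - 1`, and let `F = |μ̂|²`. The self-similarity gives `F(x) = |M(ρx)|² F(ρx)`, hence
`F(x) = P_n(x) F(ρⁿx)` where `P_n` belongs to the `n`-th step approximation of `μ`, a uniform
distribution on `Nⁿ` digit words. If `Λ` were a spectrum, then Parseval's identity would say that
`∑ F(x + l) = 1`, the sum over `l ∈ Λ`, for every `x`. This is refuted at one point, as follows.

* Orthogonality means that all differences in `Λ` are of the form `(q/p)^k c / N` with `k ≥ 1` and
  `N ∤ c`. As `N ∣ q` and `p` is coprime to `q`, the exponent `k` of a single difference bounds the
  denominators of all of them (`exists_common_denominator`), so a translate `Γ` of `Λ` lies in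
  `(1/D) ℤ`. A difference with exponent `k` is then at least `q^k / (N D)` in modulus, so the
  differences within `Γ_n = Γ ∩ {2 D |a| < q^n}` have exponents at most `n`: the frequencies in
  `Γ_n` are orthogonal already for the `n`-th step approximation, and Bessel's inequality gives
  `∑_{a ∈ Γ_n} P_n(t + a) ≤ 1` (`sum_maskProd_le_one`).
* Let `d_n = 1 - ∑_{a ∈ Γ_n} F(t + a)` with `t = 1 / (2D)`. It is positive, and if `c` bounds
  `F(ρ^m (t + a))` for `a ∈ Γ_m \ Γ_n`, then `d_m ≥ (1 - c) d_n`
  (`IsMaskRefinable.one_sub_mul_le`). For `m = n + ⌊n/q⌋` the points `ρ^m (t + a)` are still of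
  modulus at least about `p^(n/q)`.
* Because `p > 1`, the function `F` decays like a power of the logarithm
  (`IsMaskRefinable.exists_decay`): if a long run of iterates `ρ^j x` stays close to integers, these
  are multiples of high powers of `p`, hence `0` or large, so that iterates of moderate size must
  regularly be away from the integers, where `|M|²` is at most some `η < 1`.

Along a geometrically growing sequence of `n` the bounds `c` are thus dominated by a geometric
series, and `d_n` stays away from `0` (`IsMaskRefinable.not_hasSum_one`).
-/

/-! ### The mask of the digits -/

/-- The mask of the digit set `{0, …, N - 1}`: the normalised exponential sum
`(1/N) ∑_{j < N} e^{2πi j x}`, i.e. the Fourier transform of the uniform distribution on the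
digits. -/
noncomputable def digitMask (N : ℕ) (x : ℝ) : ℂ :=
  (N : ℂ)⁻¹ * ∑ j ∈ Finset.range N, Complex.exp (2 * Real.pi * x * Complex.I) ^ j

theorem norm_exp_two_pi_mul_I (x : ℝ) : ‖Complex.exp (2 * Real.pi * x * Complex.I)‖ = 1 := by
  have := Complex.norm_exp_ofReal_mul_I (2 * Real.pi * x)
  push_cast at this
  exact this

theorem exp_two_pi_mul_I_eq_one_iff (x : ℝ) :
    Complex.exp (2 * Real.pi * x * Complex.I) = 1 ↔ ∃ m : ℤ, x = m := by
  rw [Complex.exp_eq_one_iff]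
  have h2 : (2 * Real.pi * Complex.I : ℂ) ≠ 0 := Complex.two_pi_I_ne_zero
  refine exists_congr fun m => ⟨fun h => ?_, fun h => ?_⟩
  · have : (2 * Real.pi * Complex.I : ℂ) * x = (2 * Real.pi * Complex.I) * m := by
      linear_combination h
    exact_mod_cast mul_left_cancel₀ h2 this
  · subst h
    push_cast
    ring

theorem continuous_digitMask (N : ℕ) : Continuous (digitMask N) := by
  unfold digitMask
  fun_prop

theorem norm_digitMask_le_one (N : ℕ) (x : ℝ) : ‖digitMask N x‖ ≤ 1 := by
  rw [digitMask, norm_mul, norm_inv, Complex.norm_natCast, inv_mul_eq_div]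
  refine div_le_one_of_le₀ ((norm_sum_le _ _).trans ?_) (by positivity)
  simp [norm_exp_two_pi_mul_I]

theorem digitMask_add_intCast (N : ℕ) (x : ℝ) (m : ℤ) : digitMask N (x + m) = digitMask N x := by
  have : Complex.exp (2 * Real.pi * ((x + m : ℝ) : ℂ) * Complex.I) =
      Complex.exp (2 * Real.pi * x * Complex.I) := by
    rw [Complex.exp_eq_exp_iff_exists_int]
    exact ⟨m, by push_cast; ring⟩
  rw [digitMask, digitMask, this]

theorem digitMask_eq_zero_iff {N : ℕ} (hN : 0 < N) (x : ℝ) :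
    digitMask N x = 0 ↔ ∃ a : ℤ, ¬ (N : ℤ) ∣ a ∧ N * x = a := by
  have hN0 : (N : ℂ) ≠ 0 := by exact_mod_cast hN.ne'
  have hNr : (N : ℝ) ≠ 0 := by exact_mod_cast hN.ne'
  set z := Complex.exp (2 * Real.pi * x * Complex.I) with hz
  have hpow : z ^ N = 1 ↔ ∃ m : ℤ, (N : ℝ) * x = m := by
    rw [← exp_two_pi_mul_I_eq_one_iff, hz, ← Complex.exp_nat_mul]
    push_cast
    ring_nf
  have hone : z = 1 ↔ ∃ m : ℤ, x = m := exp_two_pi_mul_I_eq_one_iff x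
  have hg : (∑ j ∈ Finset.range N, z ^ j) * (z - 1) = z ^ N - 1 := geom_sum_mul z N
  have hm : digitMask N x = 0 ↔ ∑ j ∈ Finset.range N, z ^ j = 0 := by
    rw [digitMask, mul_eq_zero, or_iff_right (inv_ne_zero hN0)]
  rw [hm]
  constructor
  · intro h
    rw [h, zero_mul] at hg
    obtain ⟨a, ha⟩ := hpow.1 (sub_eq_zero.1 hg.symm)
    refine ⟨a, ?_, ha⟩
    rintro ⟨m, rfl⟩
    have hz1 : z = 1 := hone.2 ⟨m, by push_cast at ha; exact mul_left_cancel₀ hNr ha⟩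
    rw [hz1] at h
    simp at h
    exact hN.ne' h
  · rintro ⟨a, ha, hx⟩
    rw [hpow.2 ⟨a, hx⟩, sub_self, mul_eq_zero] at hg
    refine hg.resolve_right fun h1 => ha ?_
    obtain ⟨m, hm⟩ := hone.1 (sub_eq_zero.1 h1)
    refine ⟨m, ?_⟩
    rw [hm] at hx
    exact_mod_cast hx.symm

theorem norm_digitMask_lt_one {N : ℕ} (hN : 1 < N) {x : ℝ} (hx : ∀ m : ℤ, x ≠ m) :
    ‖digitMask N x‖ < 1 := by
  have hN0 : (0 : ℝ) < N := by exact_mod_cast Nat.zero_lt_of_lt hN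
  set z := Complex.exp (2 * Real.pi * x * Complex.I) with hz
  have hz1 : z ≠ 1 := fun h => by
    obtain ⟨m, hm⟩ := (exp_two_pi_mul_I_eq_one_iff x).1 h
    exact hx m hm
  have hzn : ‖z‖ = 1 := norm_exp_two_pi_mul_I x
  -- Already the first two digits fail to be aligned.
  have h2 : ‖1 + z‖ < 2 := by
    have hs : ¬ SameRay ℝ (1 : ℂ) z := by
      rw [sameRay_iff_of_norm_eq (by simp [hzn])]
      exact fun h => hz1 h.symm
    have := norm_add_lt_of_not_sameRay hs
    rw [hzn, norm_one] at this
    linarith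
  obtain ⟨M, rfl⟩ : ∃ M, N = M + 2 := ⟨N - 2, by omega⟩
  rw [digitMask, norm_mul, norm_inv, Complex.norm_natCast, inv_mul_eq_div, div_lt_one hN0,
    Finset.range_eq_Ico, ← Finset.sum_Ico_consecutive _ (Nat.zero_le 2) (by omega : 2 ≤ M + 2)]
  refine (norm_add_le _ _).trans_lt ?_
  have h3 : ‖∑ j ∈ Finset.Ico 2 (M + 2), z ^ j‖ ≤ M := by
    refine (norm_sum_le _ _).trans ?_
    simp [hzn]
  have h4 : ∑ j ∈ Finset.Ico 0 2, z ^ j = 1 + z := by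
    simp [Finset.sum_range_succ]
  rw [h4]
  push_cast
  linarith

/-- Away from the integers the mask is bounded by a constant smaller than one. -/
theorem exists_norm_sq_digitMask_le {N : ℕ} (hN : 1 < N) {ε : ℝ} (hε : 0 < ε) :
    ∃ η : ℝ, 0 ≤ η ∧ η < 1 ∧
      ∀ x : ℝ, (∀ m : ℤ, ε ≤ |x - m|) → ‖digitMask N x‖ ^ 2 ≤ η := by
  have hcont : ContinuousOn (fun x => ‖digitMask N x‖ ^ 2) (Set.Icc ε (1 - ε)) :=
    ((continuous_digitMask N).norm.pow 2).continuousOn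
  have hfr : ∀ x : ℝ, (∀ m : ℤ, ε ≤ |x - m|) → Int.fract x ∈ Set.Icc ε (1 - ε) := by
    intro x hx
    have h1 := hx ⌊x⌋
    have h2 := hx (⌊x⌋ + 1)
    push_cast at h2
    have h3 := Int.fract_lt_one x
    have h4 := Int.fract_nonneg x
    have h5 : x - ⌊x⌋ = Int.fract x := rfl
    rw [h5, abs_of_nonneg h4] at h1
    rw [show x - (⌊x⌋ + 1) = Int.fract x - 1 by rw [← h5]; ring, abs_of_neg (by linarith)] at h2
    exact ⟨h1, by linarith⟩
  rcases (Set.Icc ε (1 - ε)).eq_empty_or_nonempty with he | hne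
  · refine ⟨0, le_rfl, one_pos, fun x hx => ?_⟩
    have := hfr x hx
    simp [he] at this
  · obtain ⟨y, hy, hmax⟩ := isCompact_Icc.exists_isMaxOn hne hcont
    refine ⟨‖digitMask N y‖ ^ 2, by positivity, ?_, fun x hx => ?_⟩
    · have hlt : ‖digitMask N y‖ < 1 := by
        refine norm_digitMask_lt_one hN fun m hm => ?_
        rw [hm] at hy
        have h0 : (0 : ℝ) < m := hε.trans_le hy.1
        have h1 : (m : ℝ) < 1 := by linarith [hy.2]
        have h0' : 0 < m := by exact_mod_cast h0
        have h1' : m < 1 := by exact_mod_cast h1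
        omega
      exact pow_lt_one₀ (norm_nonneg _) hlt two_ne_zero
    · have h := hmax (hfr x hx)
      have hx' : digitMask N x = digitMask N (Int.fract x) := by
        conv_lhs => rw [← Int.fract_add_floor x]
        exact digitMask_add_intCast N _ _
      rw [hx']
      exact h

/-! ### Finite products and Bessel's inequality -/

/-- The squared modulus `∏_{k=1}^n |M(ρ^k x)|²` of the Fourier transform of the `n`-th step
approximation of the self-similar measure, `M` being the mask of the digits. -/
noncomputable def maskProd (ρ : ℝ) (N n : ℕ) (x : ℝ) : ℝ :=
  ∏ k ∈ Finset.range n, ‖digitMask N (ρ ^ (k + 1) * x)‖ ^ 2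

theorem maskProd_nonneg (ρ : ℝ) (N n : ℕ) (x : ℝ) : 0 ≤ maskProd ρ N n x :=
  Finset.prod_nonneg fun _ _ => by positivity

theorem maskProd_le_factor (ρ : ℝ) (N : ℕ) {n k : ℕ} (hk : k < n) (x : ℝ) :
    maskProd ρ N n x ≤ ‖digitMask N (ρ ^ (k + 1) * x)‖ ^ 2 := by
  rw [maskProd, ← Finset.mul_prod_erase _ _ (Finset.mem_range.2 hk)]
  refine mul_le_of_le_one_right (by positivity) (Finset.prod_le_one (fun _ _ => by positivity) ?_)
  exact fun i _ => pow_le_one₀ (norm_nonneg _) (norm_digitMask_le_one N _)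

/-- The exponential with frequency `a` in `L²` of the uniform distribution on the digit words
`d` of length `n`, each word standing for the point `∑_k ρ^(k+1) d_k`. -/
noncomputable def wordExp (ρ : ℝ) (N n : ℕ) (a : ℝ) : EuclideanSpace ℂ (Fin n → Fin N) :=
  WithLp.toLp 2 fun d => ((Real.sqrt ((N : ℝ) ^ n))⁻¹ : ℝ) *
    ∏ k : Fin n, Complex.exp (2 * Real.pi * ((ρ ^ ((k : ℕ) + 1) * a : ℝ) : ℂ) * Complex.I) ^
      (d k : ℕ)

theorem inner_wordExp (ρ : ℝ) (N n : ℕ) (a b : ℝ) :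
    inner ℂ (wordExp ρ N n a) (wordExp ρ N n b) =
      ∏ k ∈ Finset.range n, digitMask N (ρ ^ (k + 1) * (b - a)) := by
  have hE : ∀ x y : ℝ, Complex.exp (2 * Real.pi * (y : ℂ) * Complex.I) *
      (starRingEnd ℂ) (Complex.exp (2 * Real.pi * (x : ℂ) * Complex.I)) =
      Complex.exp (2 * Real.pi * ((y - x : ℝ) : ℂ) * Complex.I) := by
    intro x y
    rw [← Complex.exp_conj, ← Complex.exp_add]
    congr 1
    simp only [map_mul, Complex.conj_I, Complex.conj_ofReal, map_ofNat]
    push_cast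
    ring
  have hc : (((Real.sqrt ((N : ℝ) ^ n))⁻¹ : ℝ) : ℂ) * (((Real.sqrt ((N : ℝ) ^ n))⁻¹ : ℝ) : ℂ) =
      ∏ _k : Fin n, (N : ℂ)⁻¹ := by
    rw [← Complex.ofReal_mul, ← mul_inv, Real.mul_self_sqrt (by positivity)]
    simp
  simp only [PiLp.inner_apply, wordExp, RCLike.inner_apply]
  rw [Finset.prod_range]
  simp only [digitMask]
  rw [Finset.prod_mul_distrib, ← hc]
  simp only [Finset.sum_range]
  rw [Finset.prod_univ_sum, Fintype.piFinset_univ, Finset.mul_sum]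
  refine Finset.sum_congr rfl fun d _ => ?_
  rw [map_mul, Complex.conj_ofReal, map_prod, mul_mul_mul_comm, ← Finset.prod_mul_distrib]
  congr 1
  refine Finset.prod_congr rfl fun k _ => ?_
  rw [map_pow, ← mul_pow, hE, mul_sub]

/-- Bessel's inequality for frequencies that are orthogonal already for the `n`-th step
approximation of the self-similar measure. -/
theorem sum_maskProd_le_one {ρ : ℝ} {N : ℕ} (hN : 0 < N) (n : ℕ) (A : Finset ℝ)
    (hA : ∀ a ∈ A, ∀ b ∈ A, a ≠ b → ∃ k < n, digitMask N (ρ ^ (k + 1) * (a - b)) = 0) (t : ℝ) :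
    ∑ a ∈ A, maskProd ρ N n (t + a) ≤ 1 := by
  have hdiag : ∀ a, inner ℂ (wordExp ρ N n a) (wordExp ρ N n a) = 1 := by
    intro a
    have hN0 : (N : ℂ) ≠ 0 := by exact_mod_cast hN.ne'
    rw [inner_wordExp]
    exact Finset.prod_eq_one fun k _ => by simp [digitMask, inv_mul_cancel₀ hN0]
  have hnorm : ∀ a, ‖wordExp ρ N n a‖ = 1 := by
    intro a
    rw [norm_eq_sqrt_re_inner (𝕜 := ℂ), hdiag a]
    simp
  have ho : Orthonormal ℂ (fun a : A => wordExp ρ N n a) := by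
    refine ⟨fun a => hnorm a, fun a b hab => ?_⟩
    obtain ⟨k, hk, h0⟩ := hA b b.2 a a.2 (fun h => hab (Subtype.ext h.symm))
    rw [inner_wordExp]
    exact Finset.prod_eq_zero (Finset.mem_range.2 hk) h0
  have hb := ho.sum_inner_products_le (wordExp ρ N n (-t)) (s := Finset.univ)
  rw [hnorm, one_pow] at hb
  refine le_trans (le_of_eq ?_) hb
  rw [← Finset.sum_coe_sort]
  refine Finset.sum_congr rfl fun a _ => ?_
  rw [norm_inner_symm, inner_wordExp, norm_prod, maskProd, ← Finset.prod_pow]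
  simp only [sub_neg_eq_add, add_comm]

/-! ### Solutions of the refinement equation -/

/-- `F` is a nonnegative function, bounded by one, that satisfies the refinement equation
`F(x) = |M(ρx)|² F(ρx)`, where `M` is the mask of the digits. The squared modulus of the Fourier
transform of the self-similar measure is such a function. -/
structure IsMaskRefinable (ρ : ℝ) (N : ℕ) (F : ℝ → ℝ) : Prop where
  nonneg : ∀ x, 0 ≤ F x
  le_one : ∀ x, F x ≤ 1
  refine_eq : ∀ x, F x = ‖digitMask N (ρ * x)‖ ^ 2 * F (ρ * x)

namespace IsMaskRefinable

variable {ρ : ℝ} {N : ℕ} {F : ℝ → ℝ}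

theorem eq_maskProd_mul (hF : IsMaskRefinable ρ N F) (n : ℕ) (x : ℝ) :
    F x = maskProd ρ N n x * F (ρ ^ n * x) := by
  induction n with
  | zero => simp [maskProd]
  | succ n ih =>
    rw [ih, hF.refine_eq (ρ ^ n * x), maskProd, maskProd, Finset.prod_range_succ, pow_succ' ρ n,
      mul_assoc ρ, mul_assoc]

theorem le_maskProd (hF : IsMaskRefinable ρ N F) (n : ℕ) (x : ℝ) : F x ≤ maskProd ρ N n x := by
  rw [hF.eq_maskProd_mul n x]
  exact mul_le_of_le_one_right (maskProd_nonneg _ _ _ _) (hF.le_one _)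

theorem lt_one (hF : IsMaskRefinable ρ N F) (h0 : 0 < ρ) (h1 : ρ < 1) (hN : 1 < N) {x : ℝ}
    (hx : x ≠ 0) : F x < 1 := by
  obtain ⟨n, hn⟩ := exists_pow_lt_of_lt_one (inv_pos.2 (abs_pos.2 hx)) h1
  have hlt : |ρ ^ (n + 1) * x| < 1 := by
    rw [abs_mul, abs_of_pos (pow_pos h0 _)]
    have h2 : ρ ^ (n + 1) ≤ ρ ^ n := pow_le_pow_of_le_one h0.le h1.le (Nat.le_succ n)
    calc ρ ^ (n + 1) * |x| ≤ ρ ^ n * |x| := by gcongr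
      _ < |x|⁻¹ * |x| := by gcongr
      _ = 1 := inv_mul_cancel₀ (abs_ne_zero.2 hx)
  refine ((hF.le_maskProd (n + 1) x).trans (maskProd_le_factor ρ N (Nat.lt_succ_self n) x)).trans_lt
    (pow_lt_one₀ (norm_nonneg _) (norm_digitMask_lt_one hN fun m hm => ?_) two_ne_zero)
  rw [hm] at hlt
  have hm0 : m = 0 := Int.abs_lt_one_iff.1 (by exact_mod_cast hlt)
  rw [hm0, Int.cast_zero] at hm
  exact (mul_ne_zero (pow_pos h0 _).ne' hx) hm

end IsMaskRefinable

/-! ### Decay at infinity -/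

/-- If all of `x, (p/q) x, …, (p/q)ⁿ x` are very close to integers, then each of these integers is
exactly `p / q` times the preceding one, so the last one is divisible by `pⁿ`. -/
theorem exists_dvd_of_near_int {p q : ℕ} (hp : 0 < p) (hq : 0 < q) (hpq : Nat.Coprime p q)
    (n : ℕ) (x : ℝ)
    (h : ∀ j ≤ n, ∃ m : ℤ, |((p : ℝ) / q) ^ j * x - m| < ((p : ℝ) + q)⁻¹) :
    ∃ m : ℤ, (p : ℤ) ^ n ∣ m ∧ |((p : ℝ) / q) ^ n * x - m| < ((p : ℝ) + q)⁻¹ := by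
  have hp' : (0 : ℝ) < p := by exact_mod_cast hp
  have hq' : (0 : ℝ) < q := by exact_mod_cast hq
  induction n with
  | zero =>
    obtain ⟨m, hm⟩ := h 0 le_rfl
    exact ⟨m, by simp, hm⟩
  | succ n ih =>
    obtain ⟨m, hdvd, hm⟩ := ih fun j hj => h j (hj.trans (Nat.le_succ n))
    obtain ⟨m', hm'⟩ := h (n + 1) le_rfl
    refine ⟨m', ?_, hm'⟩
    set y := ((p : ℝ) / q) ^ n * x with hy
    have hy' : ((p : ℝ) / q) ^ (n + 1) * x = p / q * y := by rw [hy, pow_succ']; ring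
    rw [hy'] at hm'
    -- The integer `q m' - p m` has absolute value less than one.
    have hlt : |((q * m' - p * m : ℤ) : ℝ)| < 1 := by
      have : ((q * m' - p * m : ℤ) : ℝ) = p * (y - m) - q * (p / q * y - m') := by
        push_cast
        field_simp
        ring
      rw [this]
      calc |p * (y - m) - q * (p / q * y - m')|
          ≤ |p * (y - m)| + |q * (p / q * y - m')| := abs_sub _ _
        _ = p * |y - m| + q * |p / q * y - m'| := by
            rw [abs_mul, abs_mul, abs_of_pos hp', abs_of_pos hq']
        _ < p * ((p : ℝ) + q)⁻¹ + q * ((p : ℝ) + q)⁻¹ := by gcongr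
        _ = 1 := by field_simp
    have heq : (q : ℤ) * m' = p * m := by
      have : (q * m' - p * m : ℤ) = 0 := Int.abs_lt_one_iff.1 (by exact_mod_cast hlt)
      linarith
    have hcop : IsCoprime ((p : ℤ) ^ (n + 1)) q := (Nat.isCoprime_iff_coprime.2 hpq).pow_left
    refine hcop.dvd_of_dvd_mul_left ?_
    rw [heq, pow_succ']
    exact mul_dvd_mul_left _ hdvd

theorem natCast_le_pow_self {p q : ℕ} (hp : 1 < p) : (q : ℝ) ≤ (p : ℝ) ^ q := by
  exact_mod_cast (Nat.lt_pow_self hp).le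

/-- One decay step: a point `x` of modulus at least `q^(q(h+1)+1)` has an iterate
`y = (p/q)^L x` still of modulus at least `q^h` with `F x ≤ η F y`. For otherwise all iterates up to
`y` would be close to integers, the one close to `y` being a nonzero multiple of `p^(L-1)`, whereas
`L` is chosen such that `|y| < p^(L-2)`. -/
theorem IsMaskRefinable.exists_decay_step {p q N : ℕ} {F : ℝ → ℝ}
    (hF : IsMaskRefinable ((p : ℝ) / q) N F) (hp : 1 < p) (hpq : Nat.Coprime p q) (hq : 1 < q)
    {η : ℝ} (hη : ∀ x : ℝ, (∀ m : ℤ, ((p : ℝ) + q)⁻¹ ≤ |x - m|) → ‖digitMask N x‖ ^ 2 ≤ η)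
    (h : ℕ) {x : ℝ} (hx : (q : ℝ) ^ (q * (h + 1) + 1) ≤ |x|) :
    ∃ L : ℕ, (q : ℝ) ^ h ≤ |((p : ℝ) / q) ^ L * x| ∧ F x ≤ η * F (((p : ℝ) / q) ^ L * x) := by
  have hp' : (1 : ℝ) < p := by exact_mod_cast hp
  have hp2 : (2 : ℝ) ≤ p := by exact_mod_cast hp
  have hq' : (1 : ℝ) < q := by exact_mod_cast hq
  have hq2 : (2 : ℝ) ≤ q := by exact_mod_cast hq
  have hpos : (0 : ℝ) < p / q := by positivity
  have hx1 : 1 ≤ |x| := (one_le_pow₀ hq'.le).trans hx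
  have hx2 : |x| ≤ (p : ℝ) ^ 2 * |x| := le_mul_of_one_le_left (abs_nonneg x) (one_le_pow₀ hp'.le)
  -- The window is chosen so that the last iterate is below `p^(n-1)`.
  obtain ⟨n, hn1, hn2⟩ := exists_nat_pow_near (hx1.trans hx2) hq'
  have hn : q * (h + 1) + 1 ≤ n :=
    Nat.lt_succ_iff.1 ((pow_lt_pow_iff_right₀ hq').1 ((hx.trans hx2).trans_lt hn2))
  set y := ((p : ℝ) / q) ^ (n + 1) * x with hy
  have hyabs : |y| = (p : ℝ) ^ (n + 1) * |x| / (q : ℝ) ^ (n + 1) := by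
    rw [hy, abs_mul, abs_of_pos (pow_pos hpos _), div_pow]
    ring
  have hylow : (q : ℝ) ^ h ≤ |y| := by
    have h1 : (q : ℝ) ^ (h + 1) ≤ (p : ℝ) ^ (n - 1) := by
      calc (q : ℝ) ^ (h + 1) ≤ ((p : ℝ) ^ q) ^ (h + 1) := by
            gcongr
            exact natCast_le_pow_self hp
        _ = (p : ℝ) ^ (q * (h + 1)) := by rw [pow_mul]
        _ ≤ (p : ℝ) ^ (n - 1) := pow_le_pow_right₀ hp'.le (by omega)
    have hpn : (p : ℝ) ^ (n + 1) = (p : ℝ) ^ (n - 1) * (p : ℝ) ^ 2 := by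
      rw [← pow_add]
      congr 1
      omega
    rw [hyabs, le_div_iff₀ (by positivity), hpn]
    calc (q : ℝ) ^ h * (q : ℝ) ^ (n + 1) = (q : ℝ) ^ (h + 1) * (q : ℝ) ^ n := by ring
      _ ≤ (p : ℝ) ^ (n - 1) * ((p : ℝ) ^ 2 * |x|) := by gcongr
      _ = _ := by ring
  have hyup : (p : ℝ) * |y| < (p : ℝ) ^ n := by
    have : (p : ℝ) * ((p : ℝ) * |y|) < p * (p : ℝ) ^ n := by
      rw [hyabs]
      calc (p : ℝ) * (p * ((p : ℝ) ^ (n + 1) * |x| / (q : ℝ) ^ (n + 1)))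
          = (p : ℝ) ^ (n + 1) * ((p : ℝ) ^ 2 * |x|) / (q : ℝ) ^ (n + 1) := by ring
        _ < (p : ℝ) ^ (n + 1) * (q : ℝ) ^ (n + 1) / (q : ℝ) ^ (n + 1) := by gcongr
        _ = p * (p : ℝ) ^ n := by
            rw [mul_div_assoc, div_self (by positivity), mul_one, pow_succ']
    exact lt_of_mul_lt_mul_left this (by positivity)
  refine ⟨n + 1, hylow, ?_⟩
  rw [hF.eq_maskProd_mul (n + 1) x]
  refine mul_le_mul_of_nonneg_right ?_ (hF.nonneg _)
  by_contra hcon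
  push Not at hcon
  have hnear : ∀ j ≤ n, ∃ m : ℤ, |((p : ℝ) / q) ^ j * (p / q * x) - m| < ((p : ℝ) + q)⁻¹ := by
    intro j hj
    by_contra hj'
    push Not at hj'
    have h1 := hη _ hj'
    have h2 := maskProd_le_factor ((p : ℝ) / q) N (Nat.lt_succ_of_le hj) x
    rw [pow_succ ((p : ℝ) / q), mul_assoc] at h2
    linarith
  obtain ⟨m, hdvd, hm⟩ := exists_dvd_of_near_int (by omega) (by omega) hpq n _ hnear
  rw [← mul_assoc, ← pow_succ, ← hy] at hm
  have hεlt : ((p : ℝ) + q)⁻¹ < 1 := inv_lt_one_of_one_lt₀ (by linarith)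
  have hy1 : 1 ≤ |y| := (one_le_pow₀ hq'.le).trans hylow
  have hm0 : m ≠ 0 := by
    rintro rfl
    rw [Int.cast_zero, sub_zero] at hm
    linarith
  have hmbig : (p : ℝ) ^ n ≤ |(m : ℝ)| := by
    have := Int.le_of_dvd (abs_pos.2 hm0) ((dvd_abs _ _).2 hdvd)
    exact_mod_cast this
  have hmy : |(m : ℝ)| ≤ |y| + |y - m| := by
    have := abs_sub_abs_le_abs_sub (m : ℝ) y
    rw [abs_sub_comm] at this
    linarith
  have hpn : (p : ℝ) ≤ (p : ℝ) ^ n := le_self_pow₀ hp'.le (by omega)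
  nlinarith

/-- `F` decays at infinity at least like a negative power of the logarithm. -/
theorem IsMaskRefinable.exists_decay {p q N : ℕ} {F : ℝ → ℝ}
    (hF : IsMaskRefinable ((p : ℝ) / q) N F) (hN : 1 < N) (hp : 1 < p) (hpq : Nat.Coprime p q)
    (hq : 1 < q) :
    ∃ η : ℝ, 0 ≤ η ∧ η < 1 ∧
      ∀ (j : ℕ) (x : ℝ), (q : ℝ) ^ ((2 * q + 1) ^ j) ≤ |x| → F x ≤ η ^ j := by
  have hq' : (1 : ℝ) < q := by exact_mod_cast hq
  obtain ⟨η, h0, h1, hη⟩ := exists_norm_sq_digitMask_le hN (ε := ((p : ℝ) + q)⁻¹) (by positivity)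
  refine ⟨η, h0, h1, fun j => ?_⟩
  induction j with
  | zero => exact fun x _ => by simpa using hF.le_one x
  | succ j ih =>
    intro x hx
    have hexp : q * ((2 * q + 1) ^ j + 1) + 1 ≤ (2 * q + 1) ^ (j + 1) := by
      have : 1 ≤ (2 * q + 1) ^ j := Nat.one_le_pow _ _ (by omega)
      rw [pow_succ]
      nlinarith
    obtain ⟨L, hL, hFL⟩ := hF.exists_decay_step hp hpq hq hη ((2 * q + 1) ^ j)
      ((pow_le_pow_right₀ hq'.le hexp).trans hx)
    calc F x ≤ η * F (((p : ℝ) / q) ^ L * x) := hFL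
      _ ≤ η * η ^ j := mul_le_mul_of_nonneg_left (ih _ hL) h0
      _ = η ^ (j + 1) := (pow_succ' η j).symm

/-! ### Failure of Parseval's identity -/

/-- The zeros of the infinite product: if `ρ^(k+1) x` is a zero of the mask and `D x` is an
integer, then the exponent `k` is controlled by the size of `x`. -/
theorem lt_of_digitMask_eq_zero {p q N D k n : ℕ} (hN : 1 < N) (hNq : N ≤ q) (hD : 0 < D)
    (hpq : Nat.Coprime p q) {x : ℝ} (hx : ∃ m : ℤ, D * x = m)
    (h0 : digitMask N (((p : ℝ) / q) ^ (k + 1) * x) = 0) (hlt : D * |x| < (q : ℝ) ^ n) :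
    k < n := by
  obtain ⟨m, hm⟩ := hx
  obtain ⟨a, ha, hax⟩ := (digitMask_eq_zero_iff (by omega) _).1 h0
  have hq : (0 : ℝ) < q := by exact_mod_cast (by omega : 0 < q)
  have hD' : (0 : ℝ) < D := by exact_mod_cast hD
  have hm0 : m ≠ 0 := by
    rintro rfl
    have hx0 : x = 0 := by simpa [hD.ne'] using hm
    rw [hx0, mul_zero, mul_zero] at hax
    have : a = 0 := by exact_mod_cast hax.symm
    exact ha (this ▸ dvd_zero _)
  have heq : (N : ℤ) * m * p ^ (k + 1) = D * a * q ^ (k + 1) := by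
    have : (N : ℝ) * m * p ^ (k + 1) = D * a * q ^ (k + 1) := by
      rw [← hm, ← hax, div_pow]
      field_simp
    exact_mod_cast this
  have hcop : IsCoprime ((q : ℤ) ^ (k + 1)) (p ^ (k + 1)) :=
    (Nat.isCoprime_iff_coprime.2 hpq.symm).pow
  have hdvd : (q : ℤ) ^ (k + 1) ∣ N * m :=
    hcop.dvd_of_dvd_mul_right ⟨D * a, by rw [heq]; ring⟩
  have hle : (q : ℤ) ^ (k + 1) ≤ |N * m| :=
    Int.le_of_dvd (abs_pos.2 (mul_ne_zero (by omega) hm0)) ((dvd_abs _ _).2 hdvd)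
  have hle' : (q : ℝ) ^ (k + 1) ≤ N * |(m : ℝ)| := by
    have : ((q : ℤ) ^ (k + 1) : ℝ) ≤ ((|N * m| : ℤ) : ℝ) := by exact_mod_cast hle
    push_cast at this
    rwa [abs_mul, Nat.abs_cast] at this
  have hmlt : |(m : ℝ)| < (q : ℝ) ^ n := by
    rw [← hm, abs_mul, abs_of_pos hD']
    exact hlt
  have hfin : (q : ℝ) ^ (k + 1) < (q : ℝ) ^ (n + 1) := by
    calc (q : ℝ) ^ (k + 1) ≤ N * |(m : ℝ)| := hle'
      _ < N * (q : ℝ) ^ n := by gcongr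
      _ ≤ q * (q : ℝ) ^ n := by gcongr
      _ = (q : ℝ) ^ (n + 1) := (pow_succ' _ _).symm
  have := (pow_lt_pow_iff_right₀ (by exact_mod_cast (by omega : 1 < q) : (1 : ℝ) < q)).1 hfin
  omega

/-- Passing from `A` to `B`, the missing mass shrinks at most by the factor `1 - c`, if `c` bounds
the value of `F` at the `n`-th iterates of the new points. -/
theorem IsMaskRefinable.one_sub_mul_le {ρ : ℝ} {N : ℕ} {F : ℝ → ℝ} (hF : IsMaskRefinable ρ N F)
    {A B : Finset ℝ} (hAB : A ⊆ B) {n : ℕ} {t c : ℝ} (hc : 0 ≤ c)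
    (hB : ∑ a ∈ B, maskProd ρ N n (t + a) ≤ 1)
    (hnew : ∀ a ∈ B \ A, F (ρ ^ n * (t + a)) ≤ c) :
    (1 - c) * (1 - ∑ a ∈ A, F (t + a)) ≤ 1 - ∑ a ∈ B, F (t + a) := by
  have h1 : ∑ a ∈ B \ A, F (t + a) ≤ c * ∑ a ∈ B \ A, maskProd ρ N n (t + a) := by
    rw [Finset.mul_sum]
    refine Finset.sum_le_sum fun a ha => ?_
    rw [hF.eq_maskProd_mul n, mul_comm]
    exact mul_le_mul_of_nonneg_right (hnew a ha) (maskProd_nonneg _ _ _ _)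
  have h2 : ∑ a ∈ A, F (t + a) ≤ ∑ a ∈ A, maskProd ρ N n (t + a) :=
    Finset.sum_le_sum fun a _ => hF.le_maskProd n _
  have h3 := Finset.sum_sdiff (f := fun a => F (t + a)) hAB
  have h4 := Finset.sum_sdiff (f := fun a => maskProd ρ N n (t + a)) hAB
  have h5 : c * ∑ a ∈ B \ A, maskProd ρ N n (t + a) ≤ c * (1 - ∑ a ∈ A, F (t + a)) :=
    mul_le_mul_of_nonneg_left (by linarith) hc
  linarith

theorem IsMaskRefinable.sum_lt_one {ρ : ℝ} {N : ℕ} {F : ℝ → ℝ} (hF : IsMaskRefinable ρ N F)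
    (h0 : 0 < ρ) (h1 : ρ < 1) (hN : 1 < N) {A : Finset ℝ} {n : ℕ} {t : ℝ}
    (hA : ∑ a ∈ A, maskProd ρ N n (t + a) ≤ 1) (ht : ∀ a ∈ A, t + a ≠ 0) :
    ∑ a ∈ A, F (t + a) < 1 := by
  by_cases hz : ∀ a ∈ A, F (t + a) = 0
  · rw [Finset.sum_eq_zero hz]
    exact one_pos
  · push Not at hz
    obtain ⟨a, ha, hFa⟩ := hz
    refine (Finset.sum_lt_sum (fun b _ => hF.le_maskProd n _) ⟨a, ha, ?_⟩).trans_le hA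
    rw [hF.eq_maskProd_mul n] at hFa ⊢
    have hpos : 0 < maskProd ρ N n (t + a) :=
      (maskProd_nonneg _ _ _ _).lt_of_ne (left_ne_zero_of_mul hFa).symm
    exact mul_lt_of_lt_one_right hpos
      (hF.lt_one h0 h1 hN (mul_ne_zero (pow_pos h0 _).ne' (ht a ha)))

/-- A positive sequence whose successive quotients are at least `(1 - η^j)^T` stays away from
zero. -/
theorem exists_pos_le_of_pow_mul_le {d : ℕ → ℝ} {η : ℝ} (h0 : 0 ≤ η) (h1 : η < 1) (T : ℕ)
    (hd : ∀ j, 0 < d j) (hstep : ∀ j, (1 - η ^ j) ^ T * d j ≤ d (j + 1)) :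
    ∃ δ > 0, ∃ J : ℕ, ∀ i, δ ≤ d (J + i) := by
  have h1' : 0 < 1 - η := by linarith
  obtain ⟨J, hJ⟩ : ∃ J : ℕ, (T : ℝ) * η ^ J * (1 - η)⁻¹ < 1 / 2 := by
    have ht : Filter.Tendsto (fun J : ℕ => (T : ℝ) * η ^ J * (1 - η)⁻¹) Filter.atTop (nhds 0) := by
      simpa using ((tendsto_pow_atTop_nhds_zero_of_lt_one h0 h1).const_mul (T : ℝ)).mul_const
        (1 - η)⁻¹
    exact (ht.eventually_lt_const (by norm_num)).exists
  have hstep' : ∀ j, (1 - T * η ^ j) * d j ≤ d (j + 1) := by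
    intro j
    refine le_trans (mul_le_mul_of_nonneg_right ?_ (hd j).le) (hstep j)
    have hle : η ^ j ≤ 1 := pow_le_one₀ h0 h1.le
    have := one_add_mul_le_pow (a := -η ^ j) (by linarith) T
    calc 1 - T * η ^ j = 1 + T * -η ^ j := by ring
      _ ≤ (1 + -η ^ j) ^ T := this
      _ = (1 - η ^ j) ^ T := by rw [sub_eq_add_neg]
  -- The factors `1 - T η^j` are multiplied out using a geometric series.
  have hsum : ∀ i, ∑ l ∈ Finset.range i, T * η ^ (J + l) ≤ 1 / 2 := by
    intro i
    have hg : ∑ l ∈ Finset.range i, η ^ l ≤ (1 - η)⁻¹ := by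
      rw [← tsum_geometric_of_lt_one h0 h1]
      exact (summable_geometric_of_lt_one h0 h1).sum_le_tsum _ fun l _ => by positivity
    have he : ∑ l ∈ Finset.range i, T * η ^ (J + l) =
        T * η ^ J * ∑ l ∈ Finset.range i, η ^ l := by
      rw [Finset.mul_sum]
      exact Finset.sum_congr rfl fun l _ => by ring
    rw [he]
    exact (mul_le_mul_of_nonneg_left hg (by positivity)).trans hJ.le
  have key : ∀ i, (1 - ∑ l ∈ Finset.range i, T * η ^ (J + l)) * d J ≤ d (J + i) := by
    intro i
    induction i with
    | zero => simp
    | succ i ih =>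
      have hs := hsum i
      have hs' := hsum (i + 1)
      rw [Finset.sum_range_succ] at hs' ⊢
      have hs0 : 0 ≤ ∑ l ∈ Finset.range i, T * η ^ (J + l) :=
        Finset.sum_nonneg fun l _ => by positivity
      have hx0 : 0 ≤ T * η ^ (J + i) := by positivity
      set s := ∑ l ∈ Finset.range i, T * η ^ (J + l)
      set x := T * η ^ (J + i)
      calc (1 - (s + x)) * d J ≤ (1 - x) * ((1 - s) * d J) := by
            rw [← mul_assoc]
            refine mul_le_mul_of_nonneg_right ?_ (hd J).le
            nlinarith [mul_nonneg hs0 hx0]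
        _ ≤ (1 - x) * d (J + i) := mul_le_mul_of_nonneg_left ih (by linarith)
        _ ≤ d (J + (i + 1)) := hstep' (J + i)
  refine ⟨1 / 2 * d J, by have := hd J; positivity, J, fun i => le_trans ?_ (key i)⟩
  exact mul_le_mul_of_nonneg_right (by linarith [hsum i]) (hd J).le

theorem finite_setOf_mul_abs_lt {Γ : Set ℝ} {D : ℕ} (hD : 0 < D)
    (hint : ∀ a ∈ Γ, ∃ m : ℤ, D * a = m) (R : ℝ) : {a ∈ Γ | 2 * D * |a| < R}.Finite := by
  have hD' : (0 : ℝ) < D := by exact_mod_cast hD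
  refine ((Set.finite_Icc (-⌈R⌉) ⌈R⌉).image fun m : ℤ => (m : ℝ) / D).subset ?_
  rintro a ⟨ha, hlt⟩
  obtain ⟨m, hm⟩ := hint a ha
  refine ⟨m, ?_, by simp only [← hm]; field_simp⟩
  have h1 : |(m : ℝ)| < R := by
    rw [← hm, abs_mul, abs_of_pos hD']
    have : 0 ≤ D * |a| := by positivity
    linarith
  have h2 : |m| ≤ ⌈R⌉ := by exact_mod_cast h1.le.trans (Int.le_ceil R)
  exact abs_le.1 h2

/-- A set of pairwise orthogonal frequencies with a common denominator `D` violates Parseval's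
identity for the exponential with frequency `-1 / (2 * D)`. -/
theorem IsMaskRefinable.not_hasSum_one {p q N D : ℕ} {F : ℝ → ℝ}
    (hF : IsMaskRefinable ((p : ℝ) / q) N F) (hN : 1 < N) (hNq : N ≤ q) (hp : 1 < p)
    (hlt : p < q) (hpq : Nat.Coprime p q) {Γ : Set ℝ} (hD : 0 < D)
    (hint : ∀ a ∈ Γ, ∃ m : ℤ, D * a = m)
    (hzero : ∀ a ∈ Γ, ∀ b ∈ Γ, a ≠ b → ∃ k : ℕ,
      digitMask N (((p : ℝ) / q) ^ (k + 1) * (a - b)) = 0) :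
    ¬ HasSum (fun a : Γ => F (1 / (2 * D) + a)) 1 := by
  intro hsum
  have hq : 1 < q := by omega
  have hp' : (1 : ℝ) < p := by exact_mod_cast hp
  have hq' : (1 : ℝ) < q := by exact_mod_cast hq
  have hD' : (0 : ℝ) < D := by exact_mod_cast hD
  have hρ0 : (0 : ℝ) < p / q := by positivity
  have hρ1 : (p : ℝ) / q < 1 := by
    rw [div_lt_one (by positivity)]
    exact_mod_cast hlt
  obtain ⟨η, hη0, hη1, hdecay⟩ := hF.exists_decay hN hp hpq hq
  set t : ℝ := 1 / (2 * D) with ht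
  have hDt : 2 * D * t = 1 := by rw [ht]; field_simp
  have htpos : 0 < t := by positivity
  let S : ℕ → Finset ℝ := fun n => (finite_setOf_mul_abs_lt hD hint ((q : ℝ) ^ n)).toFinset
  have hS : ∀ n a, a ∈ S n ↔ a ∈ Γ ∧ 2 * D * |a| < (q : ℝ) ^ n := by
    intro n a
    simp [S]
  have hbessel : ∀ n, ∑ a ∈ S n, maskProd ((p : ℝ) / q) N n (t + a) ≤ 1 := by
    intro n
    refine sum_maskProd_le_one (by omega) n (S n) (fun a ha b hb hab => ?_) t
    obtain ⟨ha, ha'⟩ := (hS n a).1 ha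
    obtain ⟨hb, hb'⟩ := (hS n b).1 hb
    obtain ⟨k, hk⟩ := hzero a ha b hb hab
    refine ⟨k, lt_of_digitMask_eq_zero hN hNq hD hpq ?_ hk ?_, hk⟩
    · obtain ⟨m, hm⟩ := hint a ha
      obtain ⟨m', hm'⟩ := hint b hb
      exact ⟨m - m', by rw [mul_sub, hm, hm']; push_cast; ring⟩
    · have := mul_le_mul_of_nonneg_left (abs_sub a b) hD'.le
      linarith
  -- The shift `t` has twice the denominator of the frequencies, so no `t + a` vanishes.
  have hne : ∀ a ∈ Γ, t + a ≠ 0 := by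
    intro a ha h
    obtain ⟨m, hm⟩ := hint a ha
    have h2 : (1 : ℝ) + 2 * m = 0 := by
      rw [← hm, ← hDt]
      linear_combination 2 * D * h
    have h3 : 1 + 2 * m = 0 := by exact_mod_cast h2
    omega
  have hmono : ∀ {n n' : ℕ}, n ≤ n' → S n ⊆ S n' := by
    intro n n' hnn a ha
    obtain ⟨ha, ha'⟩ := (hS n a).1 ha
    exact (hS n' a).2 ⟨ha, ha'.trans_le (pow_le_pow_right₀ hq'.le hnn)⟩
  let d : ℕ → ℝ := fun n => 1 - ∑ a ∈ S n, F (t + a)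
  have hdpos : ∀ n, 0 < d n := by
    intro n
    have := hF.sum_lt_one hρ0 hρ1 hN (hbessel n) fun a ha => hne a ((hS n a).1 ha).1
    simpa [d] using this
  -- The offset `4 * D + q` in `v` makes `p^(v j)` exceed `4 D` times the threshold `q^(s^j)` beyond
  -- which `F ≤ η^j`.
  let s : ℕ := 2 * q + 1
  let v : ℕ → ℕ := fun j => s ^ (4 * D + q + j)
  have hv : ∀ j, 4 * D * (q : ℝ) ^ (s ^ j) ≤ (p : ℝ) ^ v j := by
    intro j
    have hs : 1 < s := by simp only [s]; omega
    have h1 : 4 * D + q * s ^ j ≤ v j := by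
      have h2 : 4 * D + q < s ^ (4 * D + q) := Nat.lt_pow_self hs
      have h3 : 1 ≤ s ^ j := Nat.one_le_pow _ _ (by omega)
      simp only [v]
      rw [pow_add]
      nlinarith
    calc 4 * D * (q : ℝ) ^ (s ^ j) ≤ (p : ℝ) ^ (4 * D) * ((p : ℝ) ^ q) ^ (s ^ j) := by
          gcongr
          · exact_mod_cast (Nat.lt_pow_self hp).le
          · exact natCast_le_pow_self hp
      _ = (p : ℝ) ^ (4 * D + q * s ^ j) := by rw [pow_add, pow_mul (p : ℝ) q]
      _ ≤ (p : ℝ) ^ v j := pow_le_pow_right₀ hp'.le h1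
  -- If `n ≥ q v`, then `q^n (p/q)^(n+v) = p^(n+v) / q^v ≥ p^v`, as `q ≤ p^q`.
  have hstep : ∀ j n, q * v j ≤ n → (1 - η ^ j) * d n ≤ d (n + v j) := by
    intro j n hn
    refine hF.one_sub_mul_le (hmono (Nat.le_add_right _ _)) (by positivity) (hbessel _) ?_
    intro a ha
    rw [Finset.mem_sdiff, hS, hS] at ha
    have hbig : (q : ℝ) ^ n ≤ 2 * D * |a| := not_lt.1 fun h => ha.2 ⟨ha.1.1, h⟩
    refine hdecay j _ ?_
    have hn0 : n ≠ 0 := by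
      have : 0 < v j := by simp only [v, s]; positivity
      have : 0 < q * v j := by positivity
      omega
    have hqn : (2 : ℝ) ≤ (q : ℝ) ^ n := by
      have h2 : (2 : ℝ) ≤ q := by exact_mod_cast hq
      exact h2.trans (le_self_pow₀ hq'.le hn0)
    have hta : (q : ℝ) ^ n ≤ 4 * D * |t + a| := by
      have h1 : |a| ≤ |t + a| + t := by
        have := abs_sub (t + a) t
        rwa [add_sub_cancel_left, abs_of_pos htpos] at this
      have h2 := mul_le_mul_of_nonneg_left h1 hD'.le
      linarith
    have hmain : 4 * D * (q : ℝ) ^ (s ^ j) ≤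
        4 * D * |((p : ℝ) / q) ^ (n + v j) * (t + a)| := by
      rw [abs_mul, abs_of_pos (pow_pos hρ0 _)]
      calc 4 * D * (q : ℝ) ^ (s ^ j) ≤ (p : ℝ) ^ v j := hv j
        _ ≤ ((p : ℝ) / q) ^ (n + v j) * (q : ℝ) ^ n := by
            have h1 : (q : ℝ) ^ v j ≤ (p : ℝ) ^ n := by
              calc (q : ℝ) ^ v j ≤ ((p : ℝ) ^ q) ^ v j := by
                    gcongr
                    exact natCast_le_pow_self hp
                _ = (p : ℝ) ^ (q * v j) := by rw [pow_mul]
                _ ≤ (p : ℝ) ^ n := pow_le_pow_right₀ hp'.le hn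
            rw [div_pow, div_mul_eq_mul_div, le_div_iff₀ (by positivity), pow_add, pow_add]
            calc (p : ℝ) ^ v j * ((q : ℝ) ^ n * (q : ℝ) ^ v j)
                ≤ (p : ℝ) ^ v j * ((q : ℝ) ^ n * (p : ℝ) ^ n) := by gcongr
              _ = _ := by ring
        _ ≤ ((p : ℝ) / q) ^ (n + v j) * (4 * D * |t + a|) := by gcongr
        _ = _ := by ring
    exact le_of_mul_le_mul_left hmain (by positivity)
  have hiter : ∀ j i, (1 - η ^ j) ^ i * d (q * v j) ≤ d (q * v j + i * v j) := by
    intro j i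
    have hle : 0 ≤ 1 - η ^ j := sub_nonneg.2 (pow_le_one₀ hη0 hη1.le)
    induction i with
    | zero => simp
    | succ i ih =>
      calc (1 - η ^ j) ^ (i + 1) * d (q * v j)
          = (1 - η ^ j) * ((1 - η ^ j) ^ i * d (q * v j)) := by ring
        _ ≤ (1 - η ^ j) * d (q * v j + i * v j) := mul_le_mul_of_nonneg_left ih hle
        _ ≤ d (q * v j + i * v j + v j) := hstep j _ (Nat.le_add_right _ _)
        _ = d (q * v j + (i + 1) * v j) := by ring_nf
  obtain ⟨δ, hδ, J, hJ⟩ := exists_pos_le_of_pow_mul_le (d := fun j => d (q * v j)) hη0 hη1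
    (2 * q * q) (fun j => hdpos _) (fun j => by
      have h1 := hiter j (2 * q * q)
      have h2 : q * v j + 2 * q * q * v j = q * v (j + 1) := by
        simp only [v, s]
        ring
      rwa [h2] at h1)
  have hbound : (1 : ℝ) ≤ 1 - δ := by
    refine hasSum_le_of_sum_le hsum fun A => ?_
    obtain ⟨m, hm⟩ := pow_unbounded_of_one_lt (∑ a ∈ A, 2 * D * |(a : ℝ)|) hq'
    have hsub : A.map (Function.Embedding.subtype _) ⊆ S (q * v (J + m)) := by
      intro a ha
      obtain ⟨b, hb, rfl⟩ := Finset.mem_map.1 ha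
      refine (hS _ _).2 ⟨b.2, ?_⟩
      have h1 : 2 * D * |(b : ℝ)| ≤ ∑ a ∈ A, 2 * D * |(a : ℝ)| :=
        Finset.single_le_sum (f := fun a : Γ => 2 * D * |(a : ℝ)|) (fun _ _ => by positivity) hb
      have h2 : m ≤ q * v (J + m) := by
        have h3 : 4 * D + q + (J + m) < v (J + m) :=
          Nat.lt_pow_self (by simp only [s]; omega)
        nlinarith
      exact (h1.trans_lt hm).trans_le (pow_le_pow_right₀ hq'.le h2)
    have h1 := Finset.sum_le_sum_of_subset_of_nonneg (f := fun a => F (t + a)) hsub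
      fun a _ _ => hF.nonneg _
    rw [Finset.sum_map] at h1
    have h2 := hJ m
    simp only [d] at h2
    simp only [Function.Embedding.subtype_apply] at h1
    linarith
  linarith

/-! ### Denominators of orthogonal frequencies -/

/-- Pairwise orthogonality forces a common denominator: if `l₁ - l₀` has the form
`(q/p)^k c / N` with `N ∤ c`, then `p^k` clears the denominators of all differences `l - l₀`. -/
theorem exists_common_denominator {p q N : ℕ} (hN : 1 < N) (hNq : N ∣ q) (hp : 0 < p)
    (hq : 0 < q) (hpq : Nat.Coprime p q) {Λ : Set ℝ} {l₀ : ℝ} (hl₀ : l₀ ∈ Λ)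
    (hzero : ∀ a ∈ Λ, ∀ b ∈ Λ, a ≠ b → ∃ k : ℕ,
      digitMask N (((p : ℝ) / q) ^ (k + 1) * (a - b)) = 0) :
    ∃ D : ℕ, 0 < D ∧ ∀ a ∈ Λ, ∃ m : ℤ, D * (a - l₀) = m := by
  by_cases hone : ∃ l₁ ∈ Λ, l₁ ≠ l₀
  swap
  · push Not at hone
    exact ⟨1, one_pos, fun a ha => ⟨0, by simp [hone a ha]⟩⟩
  obtain ⟨l₁, hl₁, hne⟩ := hone
  have hN0 : (N : ℝ) ≠ 0 := by exact_mod_cast (by omega : N ≠ 0)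
  have hp0 : (p : ℝ) ≠ 0 := by exact_mod_cast hp.ne'
  have hq0 : (q : ℝ) ≠ 0 := by exact_mod_cast hq.ne'
  have hlevel : ∀ a ∈ Λ, ∀ b ∈ Λ, a ≠ b → ∃ (k : ℕ) (c : ℤ), ¬ (N : ℤ) ∣ c ∧
      N * (p : ℝ) ^ (k + 1) * (a - b) = c * (q : ℝ) ^ (k + 1) := by
    intro a ha b hb hab
    obtain ⟨k, hk⟩ := hzero a ha b hb hab
    obtain ⟨c, hc, hc'⟩ := (digitMask_eq_zero_iff (by omega) _).1 hk
    refine ⟨k, c, hc, ?_⟩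
    rw [← hc', div_pow]
    field_simp
  obtain ⟨r, hr⟩ := hNq
  have hr' : (q : ℝ) = N * r := by exact_mod_cast hr
  have hint : ∀ (k j : ℕ) (c : ℤ) (x : ℝ), j ≤ k →
      N * (p : ℝ) ^ (j + 1) * x = c * (q : ℝ) ^ (j + 1) →
      ∃ m : ℤ, ((p ^ (k + 1) : ℕ) : ℝ) * x = m := by
    intro k j c x hjk hx
    refine ⟨p ^ (k - j) * c * r * q ^ j, mul_left_cancel₀ hN0 ?_⟩
    have hk : k + 1 = (k - j) + (j + 1) := by omega
    push_cast
    rw [hk, pow_add]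
    calc N * ((p : ℝ) ^ (k - j) * (p : ℝ) ^ (j + 1) * x)
        = (p : ℝ) ^ (k - j) * (N * (p : ℝ) ^ (j + 1) * x) := by ring
      _ = (p : ℝ) ^ (k - j) * c * ((q : ℝ) * (q : ℝ) ^ j) := by rw [hx]; ring
      _ = N * ((p : ℝ) ^ (k - j) * c * r * (q : ℝ) ^ j) := by
          linear_combination (p : ℝ) ^ (k - j) * c * (q : ℝ) ^ j * hr'
  obtain ⟨k, c₁, hc₁, h₁⟩ := hlevel l₁ hl₁ l₀ hl₀ hne
  refine ⟨p ^ (k + 1), by positivity, fun a ha => ?_⟩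
  by_cases ha0 : a = l₀
  · exact ⟨0, by simp [ha0]⟩
  obtain ⟨j, c, -, h⟩ := hlevel a ha l₀ hl₀ ha0
  rcases le_or_gt j k with hjk | hjk
  · exact hint k j c _ hjk h
  by_cases ha1 : a = l₁
  · exact ha1 ▸ hint k k c₁ _ le_rfl h₁
  obtain ⟨i, c', -, h'⟩ := hlevel a ha l₁ hl₁ ha1
  rcases le_or_gt i k with hik | hik
  · obtain ⟨m, hm⟩ := hint k i c' _ hik h'
    obtain ⟨m₁, hm₁⟩ := hint k k c₁ _ le_rfl h₁
    exact ⟨m + m₁, by push_cast at hm hm₁ ⊢; rw [← hm, ← hm₁]; ring⟩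
  -- If both exponents exceed that of `l₁ - l₀ = (a - l₀) - (a - l₁)`, then clearing denominators
  -- exhibits `N` as a divisor of `c₁` times a power of `p`.
  exfalso
  obtain ⟨j, rfl⟩ : ∃ j', j = k + 1 + j' := ⟨j - (k + 1), by omega⟩
  obtain ⟨i, rfl⟩ : ∃ i', i = k + 1 + i' := ⟨i - (k + 1), by omega⟩
  have heq : c₁ * (p : ℝ) ^ (j + 1 + i + 1 + k + 1) =
      N * (r * ((q : ℝ) ^ j * c * (p : ℝ) ^ (i + 1 + k + 1) -
        (q : ℝ) ^ i * c' * (p : ℝ) ^ (j + 1 + k + 1))) := by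
    have hqk : (q : ℝ) ^ (k + 1) ≠ 0 := pow_ne_zero _ hq0
    refine mul_right_cancel₀ hqk ?_
    rw [← mul_assoc (N : ℝ), ← hr']
    linear_combination (-(p : ℝ) ^ (j + 1 + i + 1 + k + 1)) * h₁ +
      (p : ℝ) ^ (i + 1 + k + 1) * h - (p : ℝ) ^ (j + 1 + k + 1) * h'
  have heq' : c₁ * (p : ℤ) ^ (j + 1 + i + 1 + k + 1) =
      N * (r * ((q : ℤ) ^ j * c * (p : ℤ) ^ (i + 1 + k + 1) -
        (q : ℤ) ^ i * c' * (p : ℤ) ^ (j + 1 + k + 1))) := by exact_mod_cast heq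
  have hNp : IsCoprime (N : ℤ) ((p : ℤ) ^ (j + 1 + i + 1 + k + 1)) :=
    (Nat.isCoprime_iff_coprime.2 (Nat.Coprime.coprime_dvd_right ⟨r, hr⟩ hpq).symm).pow_right
  exact hc₁ (hNp.dvd_of_dvd_mul_right ⟨_, heq'⟩)

/-! ### The Fourier transform of the measure and spectra -/

theorem IsBernoulliSelfSimilar.isMaskRefinable {ρ : ℝ} (hρ : 0 < ρ) {N : ℕ} {μ : Measure ℝ}
    [IsProbabilityMeasure μ] (h : IsBernoulliSelfSimilar ρ N μ) :
    IsMaskRefinable ρ N fun x => ‖charFun μ (2 * Real.pi * x)‖ ^ 2 where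
  nonneg _ := by positivity
  le_one _ := pow_le_one₀ (norm_nonneg _) (norm_charFun_le_one _)
  refine_eq x := by
    have hmask : (N : ℂ)⁻¹ * ∑ j ∈ Finset.range N,
        Complex.exp (ρ * ((2 * Real.pi * x : ℝ) : ℂ) * j * Complex.I) = digitMask N (ρ * x) := by
      rw [digitMask]
      congr 1
      refine Finset.sum_congr rfl fun j _ => ?_
      rw [← Complex.exp_nat_mul]
      congr 1
      push_cast
      ring
    rw [h.charFun_eq hρ, hmask, norm_mul, mul_pow, show ρ * (2 * Real.pi * x) =
      2 * Real.pi * (ρ * x) by ring]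

/-- A zero of the Fourier transform is a zero of one of the factors of the infinite product. -/
theorem IsMaskRefinable.exists_digitMask_eq_zero {ρ : ℝ} {N : ℕ} {F : ℝ → ℝ}
    (hF : IsMaskRefinable ρ N F) (h0 : 0 < ρ) (h1 : ρ < 1) (hc : ContinuousAt F 0)
    (hF0 : F 0 ≠ 0) {x : ℝ} (hx : F x = 0) : ∃ k : ℕ, digitMask N (ρ ^ (k + 1) * x) = 0 := by
  have ht : Filter.Tendsto (fun n : ℕ => ρ ^ n * x) Filter.atTop (nhds 0) := by
    simpa using (tendsto_pow_atTop_nhds_zero_of_lt_one h0.le h1).mul_const x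
  obtain ⟨n, hn⟩ := ((hc.tendsto.comp ht).eventually_ne hF0).exists
  rw [Function.comp_apply] at hn
  rw [hF.eq_maskProd_mul n, mul_eq_zero, or_iff_left hn, maskProd, Finset.prod_eq_zero_iff] at hx
  obtain ⟨k, -, hk⟩ := hx
  exact ⟨k, by simpa using hk⟩

theorem inner_expL2 (μ : Measure ℝ) [IsFiniteMeasure μ] (a b : ℝ) :
    inner ℂ (expL2 μ a) (expL2 μ b) = charFun μ (2 * Real.pi * (a - b)) := by
  rw [L2.inner_def, charFun_apply_real]
  refine integral_congr_ae ?_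
  filter_upwards [(memLp_expFun μ a).coeFn_toLp, (memLp_expFun μ b).coeFn_toLp] with x ha hb
  rw [expL2, expL2, ha, hb, RCLike.inner_apply, expFun, expFun, ← Complex.exp_conj,
    ← Complex.exp_add]
  congr 1
  simp only [map_neg, map_mul, Complex.conj_I, Complex.conj_ofReal, map_ofNat]
  push_cast
  ring

theorem IsSpectrum.charFun_eq_zero {μ : Measure ℝ} [IsProbabilityMeasure μ] {Λ : Set ℝ}
    (h : IsSpectrum μ Λ) {a b : ℝ} (ha : a ∈ Λ) (hb : b ∈ Λ) (hab : a ≠ b) :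
    charFun μ (2 * Real.pi * (a - b)) = 0 := by
  obtain ⟨-, B, hB⟩ := h
  have := B.orthonormal.2 (i := ⟨a, ha⟩) (j := ⟨b, hb⟩) fun h => hab (congrArg Subtype.val h)
  simpa only [hB, inner_expL2] using this

/-- Parseval's identity for an exponential function expanded in a spectrum. -/
theorem IsSpectrum.hasSum_norm_sq_charFun {μ : Measure ℝ} [IsProbabilityMeasure μ] {Λ : Set ℝ}
    (h : IsSpectrum μ Λ) (t : ℝ) :
    HasSum (fun l : Λ => ‖charFun μ (2 * Real.pi * (l - t))‖ ^ 2) 1 := by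
  obtain ⟨-, B, hB⟩ := h
  have hs := B.hasSum_inner_mul_inner (expL2 μ t) (expL2 μ t)
  simp only [inner_expL2, hB, sub_self, mul_zero, charFun_zero, probReal_univ,
    Complex.ofReal_one] at hs
  have hre := Complex.hasSum_re hs
  rw [Complex.one_re] at hre
  refine hre.congr_fun fun l => ?_
  have hneg : 2 * Real.pi * (t - l) = -(2 * Real.pi * (l - t)) := by ring
  rw [hneg, charFun_neg, ← Complex.normSq_eq_conj_mul_self, Complex.ofReal_re,
    Complex.normSq_eq_norm_sq]

theorem IsBernoulliSelfSimilar.not_isSpectrum {ρ : ℝ} {N p q : ℕ} (h0 : 0 < ρ) (h1 : ρ < 1)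
    (hN : 1 < N) (hρ : ρ = (p : ℝ) / (q : ℝ)) (hpq : Nat.Coprime p q) (hp : 1 < p) (hNq : N ∣ q)
    {μ : Measure ℝ} [IsProbabilityMeasure μ] (hμ : IsBernoulliSelfSimilar ρ N μ) (Λ : Set ℝ) :
    ¬ IsSpectrum μ Λ := by
  intro hΛ
  have hF := hμ.isMaskRefinable h0
  have hq : 0 < q := Nat.pos_of_ne_zero fun hq => by simp [hρ, hq] at h0
  have hlt : p < q := by
    rw [hρ, div_lt_one (by exact_mod_cast hq)] at h1
    exact_mod_cast h1
  have hcont : Continuous fun x : ℝ => ‖charFun μ (2 * Real.pi * x)‖ ^ 2 :=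
    ((continuous_charFun.comp (continuous_const.mul continuous_id)).norm.pow 2)
  have hzero : ∀ a ∈ Λ, ∀ b ∈ Λ, a ≠ b → ∃ k : ℕ,
      digitMask N (((p : ℝ) / q) ^ (k + 1) * (a - b)) = 0 := by
    intro a ha b hb hab
    rw [← hρ]
    exact hF.exists_digitMask_eq_zero h0 h1 hcont.continuousAt (by simp)
      (by simp [hΛ.charFun_eq_zero ha hb hab])
  obtain ⟨l₀, hl₀⟩ : Λ.Nonempty := by
    rw [Set.nonempty_iff_ne_empty]
    rintro rfl
    exact zero_ne_one ((hasSum_empty).unique (hΛ.hasSum_norm_sq_charFun 0))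
  obtain ⟨D, hD, hint⟩ := exists_common_denominator hN hNq (by omega) hq hpq hl₀ hzero
  rw [hρ] at hF
  refine hF.not_hasSum_one hN (Nat.le_of_dvd hq hNq) hp hlt hpq
    (Γ := Equiv.subRight l₀ '' Λ) hD ?_ ?_ ?_
  · rintro _ ⟨a, ha, rfl⟩
    exact hint a ha
  · rintro _ ⟨a, ha, rfl⟩ _ ⟨b, hb, rfl⟩ hab
    obtain ⟨k, hk⟩ := hzero a ha b hb fun h => hab (by rw [h])
    exact ⟨k, by simpa using hk⟩
  · rw [← ((Equiv.subRight l₀).image Λ).hasSum_iff]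
    refine (hΛ.hasSum_norm_sq_charFun (l₀ - 1 / (2 * D))).congr_fun fun l => ?_
    simp only [Function.comp_apply, Equiv.image_apply_coe, Equiv.subRight_apply]
    ring_nf

theorem proposition3p2 (ρ : ℝ) (N p q : ℕ) (h0 : 0 < ρ) (h1 : ρ < 1) (hN : 1 < N)
    (hρ : ρ = (p : ℝ) / (q : ℝ)) (hpq : Nat.Coprime p q) (hp : 1 < p) (hNq : N ∣ q) :
    ¬ IsSpectralMeasure (nBernoulli ρ N h0 h1 (Nat.zero_lt_of_lt hN)) := by
  rintro ⟨Λ, hΛ⟩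
  exact (nBernoulli_selfSimilar ρ N h0 h1 (Nat.zero_lt_of_lt hN)).not_isSpectrum h0 h1 hN hρ hpq hp
    hNq Λ hΛ
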